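/- For $n, m \in \mathbb{N} = \{0,1,2,\dots\}$, let $D^o_{2,1}(n,m)$ be the number of partitions of $n$ into $m$ parts in which every part is at least $2$, any two successive parts (with the parts listed in increasing order) differ by at least $2$, and any two successive parts that are not both odd differ by at least $3$; the empty partition is counted, so $D^o_{2,1}(0,0)=1$. For $k \ge 0$ write $(a;q)_k = \prod_{j=1}^{k} (1 - a q^{j-1})$, with the empty product equal to $1$. Then, as an identity of formal power series in $\mathbb{Z}[[q,x]]$, $$ \sum_{m,n \ge 0} D^o_{2,1}(n,m)\, q^n x^m = \sum_{n_1,n_2 \ge 0} \frac{ q^{4n_2^2 + 4n_2 + (3n_1^2+3n_1)/2 + 4 n_2 n_1}\,\bigl(1 + x q^{4n_2+2n_1+2}\bigr)\, x^{2n_2+n_1} } { (q;q)_{n_1}\,(q^4;q^4)_{n_2} }, $$ where the double series on the right converges coefficientwise. -/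

import Mathlib

open scoped MvPowerSeries.WithPiTopology

/-- The `q`-Pochhammer symbol `(a; q)_n = (1 - a) (1 - a q) ⋯ (1 - a q ^ (n - 1))`. -/
def qPoch {R : Type*} [CommRing R] (a q : R) (n : ℕ) : R :=
  ∏ j ∈ Finset.range n, (1 - a * q ^ j)

/-- The difference condition on two successive parts `a ≤ b`: the difference is at least two,
and at least three unless both parts are odd. -/
def GGStep (a b : ℕ) : Prop :=
  a + 2 ≤ b ∧ (¬ (Odd a ∧ Odd b) → a + 3 ≤ b)

instance : DecidableRel GGStep := fun a b =>
  inferInstanceAs (Decidable (a + 2 ≤ b ∧ (¬ (Odd a ∧ Odd b) → a + 3 ≤ b)))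

/-- The number of partitions of `n` into `m` parts in which the smallest part is at least two,
and any two successive parts (in increasing order) satisfy `GGStep`. The empty partition of `0`
into `0` parts is counted. -/
def partitionCountDo21 (n m : ℕ) : ℕ :=
  (Finset.univ.filter fun p : n.Partition =>
    p.parts.card = m ∧ (∀ i ∈ p.parts, 2 ≤ i) ∧
      (p.parts.sort (· ≤ ·)).IsChain GGStep).card

/-- The ring `ℤ⟦q, x⟧` of formal power series in two variables. -/
abbrev SeriesQX : Type := MvPowerSeries (Fin 2) ℤ

/-- The variable `q`. -/
noncomputable def varQ : SeriesQX := MvPowerSeries.X 0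

/-- The variable `x`. -/
noncomputable def varX : SeriesQX := MvPowerSeries.X 1

/-- The formal power series `∑ c n m * q ^ n * x ^ m`, given by its coefficients. -/
def genFunQX (c : ℕ → ℕ → ℕ) : SeriesQX := fun d => (c (d 0) (d 1) : ℤ)

/-- The denominator `(q; q)_{n₁} (q⁴; q⁴)_{n₂}`. -/
noncomputable def denomGG (n₁ n₂ : ℕ) : SeriesQX :=
  qPoch varQ varQ n₁ * qPoch (varQ ^ 4) (varQ ^ 4) n₂

/-- The multiplicative inverse of the denominator in `ℤ⟦q, x⟧`; see `denomGG_mul_invDenomGG`. -/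
noncomputable def invDenomGG (n₁ n₂ : ℕ) : SeriesQX :=
  MvPowerSeries.invOfUnit (denomGG n₁ n₂) 1

theorem constantCoeff_denomGG (n₁ n₂ : ℕ) :
    MvPowerSeries.constantCoeff (denomGG n₁ n₂) = 1 := by
  simp [denomGG, qPoch, varQ, map_prod]

theorem denomGG_mul_invDenomGG (n₁ n₂ : ℕ) : denomGG n₁ n₂ * invDenomGG n₁ n₂ = 1 :=
  MvPowerSeries.mul_invOfUnit _ _ (by simp [constantCoeff_denomGG])

/-! Compare coefficients of `x ^ m`. Let `G_k(m)` be the series in `q` counting admissible lists of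
`m` parts, all at least `k`. Removing a smallest part `1` or `2`, and shifting all parts by `2`
(which preserves parities), gives `(1 - q^(2m+2)) G_1(m+1) = q^(2m+1) (1 + q^(2m+1)) G_1(m)` and
expresses `G_2` through `G_1` (`ggRow_one_succ`, `ggRow_two_succ`). On the other side, `F(z) = (-z;
q)_∞ / (z²; q⁴)_∞` satisfies `(1 - z) F(z) = (1 + q z) F(q² z)`, so its coefficients `c_m` obey the
same recurrence up to `q^(m²)`, and `G_1(m) = q^(m²) c_m` (`ggRow_one_eq`). Expanding `F` by Euler's
two series writes `c_m` as a sum over `2 n₂ + n₁ = m`. The two terms of `G_2` then match the two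
terms of `1 + x q^(4n₂+2n₁+2)`. -/

theorem GGStep.lt {a b : ℕ} (h : GGStep a b) : a < b := by
  have := h.1
  omega

theorem pairwise_lt_of_isChain_GGStep {l : List ℕ} (h : l.IsChain GGStep) :
    l.Pairwise (· < ·) :=
  List.isChain_iff_pairwise.1 (h.imp fun _ _ => GGStep.lt)

theorem sort_coe_of_isChain_GGStep {l : List ℕ} (h : l.IsChain GGStep) :
    (l : Multiset ℕ).sort (· ≤ ·) = l := by
  rw [Multiset.coe_sort]
  exact List.mergeSort_of_pairwise
    (((pairwise_lt_of_isChain_GGStep h).imp fun {_ _} hab => by simpa using hab.le))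

/-! ### Admissible lists: removing the smallest part and shifting -/

/-- The increasing lists of `m` numbers at least `k`, with sum `n`, whose successive entries
satisfy `GGStep`. -/
def ggLists (k n m : ℕ) : Finset (List ℕ) :=
  (Finset.univ.filter fun p : n.Partition =>
    p.parts.card = m ∧ (∀ i ∈ p.parts, k ≤ i) ∧
      (p.parts.sort (· ≤ ·)).IsChain GGStep).image fun p => p.parts.sort (· ≤ ·)

theorem card_ggLists_two (n m : ℕ) : (ggLists 2 n m).card = partitionCountDo21 n m := by
  refine Finset.card_image_of_injective _ fun p p' h => ?_
  have h' := congrArg (fun l : List ℕ => (l : Multiset ℕ)) h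
  simp only [Multiset.sort_eq] at h'
  exact Nat.Partition.ext h'

theorem mem_ggLists {k n m : ℕ} (hk : 0 < k) {l : List ℕ} :
    l ∈ ggLists k n m ↔
      l.sum = n ∧ l.length = m ∧ (∀ i ∈ l, k ≤ i) ∧ l.IsChain GGStep := by
  simp only [ggLists, Finset.mem_image, Finset.mem_filter, Finset.mem_univ, true_and]
  constructor
  · rintro ⟨p, ⟨hc, hm, hs⟩, rfl⟩
    refine ⟨?_, by simpa using hc, by simpa using hm, hs⟩
    rw [← Multiset.sum_coe, Multiset.sort_eq, p.parts_sum]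
  · rintro ⟨hn, hm, hi, hc⟩
    refine ⟨⟨l, fun {i} hi' => hk.trans_le (hi i (by simpa using hi')), by simpa using hn⟩, ?_⟩
    simp only [sort_coe_of_isChain_GGStep hc]
    exact ⟨⟨by simpa using hm, by simpa using hi, hc⟩, trivial⟩

theorem isChain_GGStep_cons {k k' : ℕ} (hk : ∀ b, GGStep k b ↔ k' ≤ b) {l : List ℕ} :
    (k :: l).IsChain GGStep ↔ (∀ i ∈ l, k' ≤ i) ∧ l.IsChain GGStep := by
  cases l with
  | nil => simp
  | cons b t =>
    rw [List.isChain_cons_cons, hk]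
    refine and_congr_left fun h => ⟨fun hb i hi => ?_, fun h => h b (by simp)⟩
    rcases List.mem_cons.1 hi with rfl | hi
    · exact hb
    · exact hb.trans (List.rel_of_pairwise_cons (pairwise_lt_of_isChain_GGStep h) hi).le

/-- Split by whether `k` occurs; if so it comes first, and `k'` is the least part allowed after it.
-/
theorem ggLists_succ_of_le {k k' n m : ℕ} (hk0 : 0 < k) (hkk : k < k')
    (hk : ∀ b, GGStep k b ↔ k' ≤ b) (hn : k ≤ n) :
    (ggLists k n (m + 1)).card =
      (ggLists (k + 1) n (m + 1)).card + (ggLists k' (n - k) m).card := by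
  have hu : ggLists k n (m + 1) =
      ggLists (k + 1) n (m + 1) ∪ (ggLists k' (n - k) m).image (List.cons k) := by
    ext l
    rw [Finset.mem_union, Finset.mem_image, mem_ggLists hk0, mem_ggLists (Nat.succ_pos k)]
    constructor
    · rintro ⟨h1, h2, h3, h4⟩
      cases l with
      | nil => simp at h2
      | cons b t =>
        rcases (h3 b (by simp)).eq_or_lt with rfl | hb
        · right
          rw [isChain_GGStep_cons hk] at h4
          refine ⟨t, (mem_ggLists (by omega)).2 ⟨?_, by simpa using h2, h4⟩, rfl⟩
          simp only [List.sum_cons] at h1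
          omega
        · left
          refine ⟨h1, h2, fun i hi => ?_, h4⟩
          rcases List.mem_cons.1 hi with rfl | hi
          · exact hb
          · exact hb.trans (List.rel_of_pairwise_cons (pairwise_lt_of_isChain_GGStep h4) hi)
    · rintro (⟨h1, h2, h3, h4⟩ | ⟨t, ht, rfl⟩)
      · exact ⟨h1, h2, fun i hi => (Nat.le_succ k).trans (h3 i hi), h4⟩
      · obtain ⟨h1, h2, h3⟩ := (mem_ggLists (by omega)).1 ht
        refine ⟨?_, by simpa using h2, ?_, (isChain_GGStep_cons hk).2 h3⟩
        · simp only [List.sum_cons]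
          omega
        · simp only [List.mem_cons, forall_eq_or_imp, le_refl, true_and]
          exact fun i hi => hkk.le.trans (h3.1 i hi)
  rw [hu, Finset.card_union_of_disjoint, Finset.card_image_of_injective _ List.cons_injective]
  rw [Finset.disjoint_left]
  intro l hl hl'
  obtain ⟨t, -, rfl⟩ := Finset.mem_image.1 hl'
  have := ((mem_ggLists (Nat.succ_pos k)).1 hl).2.2.1 k (by simp)
  omega

theorem ggLists_eq_empty {k n m : ℕ} (hk : 0 < k) (h : n < k * m) : ggLists k n m = ∅ := by
  refine Finset.eq_empty_of_forall_notMem fun l hl => ?_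
  obtain ⟨h1, h2, h3, -⟩ := (mem_ggLists hk).1 hl
  have := List.card_nsmul_le_sum l k h3
  rw [h1, h2, smul_eq_mul, mul_comm] at this
  omega

theorem GGStep_add_two {a b : ℕ} : GGStep (a + 2) (b + 2) ↔ GGStep a b := by
  simp only [GGStep, Nat.odd_iff]
  omega

theorem card_ggLists_add_two {k n m : ℕ} (hk : 0 < k) :
    (ggLists (k + 2) (n + 2 * m) m).card = (ggLists k n m).card := by
  have hu : ggLists (k + 2) (n + 2 * m) m = (ggLists k n m).image (List.map (· + 2)) := by
    ext l
    rw [Finset.mem_image, mem_ggLists (by omega)]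
    have key : ∀ t : List ℕ, (t.map (· + 2)).sum = t.sum + 2 * t.length := by
      intro t
      induction t with
      | nil => simp
      | cons a t ih => simp only [List.map_cons, List.sum_cons, ih, List.length_cons]; ring
    constructor
    · rintro ⟨h1, h2, h3, h4⟩
      have hl : (l.map (· - 2)).map (· + 2) = l := by
        rw [List.map_map]
        conv_rhs => rw [← List.map_id l]
        refine List.map_congr_left fun i hi => ?_
        have := h3 i hi
        simp only [Function.comp_apply, id]
        omega
      refine ⟨l.map (· - 2), (mem_ggLists hk).2 ⟨?_, by simpa using h2, ?_, ?_⟩, hl⟩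
      · have := key (l.map (· - 2))
        rw [hl, List.length_map] at this
        omega
      · intro i hi
        obtain ⟨j, hj, rfl⟩ := List.mem_map.1 hi
        have := h3 j hj
        omega
      · rw [← hl, List.isChain_map] at h4
        exact h4.imp fun _ _ => GGStep_add_two.1
    · rintro ⟨t, ht, rfl⟩
      obtain ⟨h1, h2, h3, h4⟩ := (mem_ggLists hk).1 ht
      refine ⟨by rw [key]; omega, by simpa using h2, ?_, ?_⟩
      · intro i hi
        obtain ⟨j, hj, rfl⟩ := List.mem_map.1 hi
        have := h3 j hj
        omega
      · rw [List.isChain_map]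
        exact h4.imp fun _ _ => GGStep_add_two.2
  rw [hu, Finset.card_image_of_injective]
  exact List.map_injective_iff.2 fun a b h => by simpa using h

/-! ### Recurrences for the row generating functions -/

open PowerSeries in
/-- The generating function, in the sum of the parts, of `ggLists k · m`. -/
noncomputable def ggRow (k m : ℕ) : ℤ⟦X⟧ := PowerSeries.mk fun n => ((ggLists k n m).card : ℤ)

open PowerSeries in
theorem ggRow_add_two {k : ℕ} (hk : 0 < k) (m : ℕ) :
    ggRow (k + 2) m = X ^ (2 * m) * ggRow k m := by
  ext n
  rw [coeff_X_pow_mul', ggRow, ggRow, coeff_mk]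
  split_ifs with h
  · obtain ⟨n, rfl⟩ := Nat.exists_eq_add_of_le' h
    rw [coeff_mk, card_ggLists_add_two hk, Nat.add_sub_cancel]
  · rw [ggLists_eq_empty (by omega) (by nlinarith)]
    simp

open PowerSeries in
theorem ggRow_succ {k k' : ℕ} (hk0 : 0 < k) (hkk : k < k')
    (hk : ∀ b, GGStep k b ↔ k' ≤ b) (m : ℕ) :
    ggRow k (m + 1) = ggRow (k + 1) (m + 1) + X ^ k * ggRow k' m := by
  ext n
  rw [map_add, coeff_X_pow_mul', ggRow, ggRow, ggRow, coeff_mk, coeff_mk]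
  split_ifs with h
  · rw [coeff_mk, ggLists_succ_of_le hk0 hkk hk h]
    push_cast
    rfl
  · rw [ggLists_eq_empty hk0 (by nlinarith), ggLists_eq_empty (Nat.succ_pos k) (by nlinarith)]
    simp

theorem ggRow_zero {k : ℕ} (hk : 0 < k) : ggRow k 0 = 1 := by
  ext n
  have h : ggLists k n 0 = if n = 0 then {[]} else ∅ := by
    ext l
    rw [mem_ggLists hk]
    cases l <;> by_cases hn : n = 0 <;> simp [hn, eq_comm]
  rw [ggRow, PowerSeries.coeff_mk, h, PowerSeries.coeff_one]
  split_ifs <;> simp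

open PowerSeries in
theorem ggRow_three (m : ℕ) : ggRow 3 m = X ^ (2 * m) * ggRow 1 m :=
  ggRow_add_two one_pos m

open PowerSeries in
theorem ggRow_two_succ (m : ℕ) :
    ggRow 2 (m + 1) = X ^ (2 * (m + 1)) * ggRow 1 (m + 1) + X ^ (4 * m + 2) * ggRow 1 m := by
  -- After the even part `2` the gap must be `3`; after `1`, a gap of `2` leads to the odd `3` and
  -- is allowed.
  have h := ggRow_succ two_pos (by norm_num : 2 < 5)
    (fun b => by simp only [GGStep, Nat.odd_iff]; omega) m
  simp only [Nat.reduceAdd] at h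
  rw [h, ggRow_add_two (k := 3) (by norm_num) m, ggRow_three, ggRow_three]
  ring

open PowerSeries in
theorem ggRow_one_succ (m : ℕ) :
    (1 - X ^ (2 * (m + 1))) * ggRow 1 (m + 1) =
      X ^ (2 * m + 1) * (1 + X ^ (2 * m + 1)) * ggRow 1 m := by
  have h := ggRow_succ one_pos (by norm_num : 1 < 3)
    (fun b => by simp only [GGStep, Nat.odd_iff]; omega) m
  simp only [Nat.reduceAdd] at h
  rw [ggRow_two_succ, ggRow_three] at h
  linear_combination h

/-! ### Euler series and the functional equation of their product -/

section PochhammerInverse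

open PowerSeries

variable {R : Type*} [CommRing R]

theorem qPoch_succ (a q : R) (n : ℕ) : qPoch a q (n + 1) = qPoch a q n * (1 - a * q ^ n) :=
  Finset.prod_range_succ _ _

theorem eq_mul_succ_of_qPoch_mul_eq_one {q : R} {a : ℕ → R} (ha : ∀ n, qPoch q q n * a n = 1)
    (n : ℕ) : a n = (1 - q ^ (n + 1)) * a (n + 1) := by
  have h := ha (n + 1)
  rw [qPoch_succ] at h
  linear_combination (-a n) * h + (1 - q * q ^ n) * a (n + 1) * ha n

theorem apply_zero_of_qPoch_mul_eq_one {q : R} {a : ℕ → R} (ha : ∀ n, qPoch q q n * a n = 1) :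
    a 0 = 1 := by
  simpa [qPoch] using ha 0

/-- The series `∑ q ^ (n choose 2) a n z ^ n`; Euler's product `(-z; q)_∞` when `a n` is the
inverse of `(q; q)_n`. -/
noncomputable def eulerSeries (q : R) (a : ℕ → R) : R⟦X⟧ :=
  PowerSeries.mk fun n => q ^ n.choose 2 * a n

/-- The series `∑ b n z ^ (2 n)`. -/
noncomputable def evenSeries (b : ℕ → R) : R⟦X⟧ :=
  PowerSeries.mk fun n => if Even n then b (n / 2) else 0

theorem eulerSeries_eq {q : R} {a : ℕ → R} (ha : ∀ n, qPoch q q n * a n = 1) :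
    eulerSeries q a = (1 + X) * rescale q (eulerSeries q a) := by
  ext n
  rw [add_mul, one_mul, map_add, coeff_rescale]
  cases n with
  | zero => simp
  | succ n =>
    rw [coeff_succ_X_mul, coeff_rescale, eulerSeries, coeff_mk, coeff_mk,
      eq_mul_succ_of_qPoch_mul_eq_one ha n, Nat.choose_succ_succ' n 1, Nat.choose_one_right]
    ring

theorem evenSeries_eq {q : R} {b : ℕ → R} (hb : ∀ n, qPoch (q ^ 4) (q ^ 4) n * b n = 1) :
    (1 - X ^ 2) * evenSeries b = rescale (q ^ 2) (evenSeries b) := by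
  ext n
  rw [sub_mul, one_mul, map_sub, coeff_rescale, coeff_X_pow_mul', evenSeries, coeff_mk]
  rcases Nat.even_or_odd' n with ⟨k, rfl | rfl⟩
  · cases k with
    | zero => simp
    | succ k =>
      rw [if_pos (by simp), if_pos (by omega), coeff_mk,
        if_pos (by rw [Nat.even_iff]; omega), show 2 * (k + 1) / 2 = k + 1 by omega,
        show (2 * (k + 1) - 2) / 2 = k by omega, eq_mul_succ_of_qPoch_mul_eq_one hb k]
      ring
  · have h : ¬ Even (2 * k + 1) := by simp
    rw [if_neg h]
    split_ifs with h2
    · rw [coeff_mk, if_neg (by rw [Nat.even_iff]; omega)]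
      simp
    · simp

/-- Replacing `z` by `q² z` removes `(1 + z)(1 + q z)` from the Euler product and `1 - z²` from the
denominator; the common factor `1 + z` cancels. -/
theorem one_sub_X_mul_eulerSeries_mul_evenSeries {q : R} {a b : ℕ → R}
    (ha : ∀ n, qPoch q q n * a n = 1) (hb : ∀ n, qPoch (q ^ 4) (q ^ 4) n * b n = 1) :
    (1 - X) * (eulerSeries q a * evenSeries b) =
      (1 + C q * X) * rescale (q ^ 2) (eulerSeries q a * evenSeries b) := by
  have hu : IsUnit (1 + X : R⟦X⟧) := by
    rw [PowerSeries.isUnit_iff_constantCoeff]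
    simp
  apply hu.mul_left_cancel
  have h1 := eulerSeries_eq ha
  have h2 := congrArg (rescale q) h1
  rw [map_mul, map_add, map_one, rescale_X, rescale_rescale, ← sq] at h2
  rw [map_mul, ← evenSeries_eq hb]
  linear_combination (1 - X ^ 2) * evenSeries b * (h1 + (1 + X) * h2)

theorem coeff_eulerSeries_mul_evenSeries_succ {q : R} {a b : ℕ → R}
    (ha : ∀ n, qPoch q q n * a n = 1) (hb : ∀ n, qPoch (q ^ 4) (q ^ 4) n * b n = 1) (m : ℕ) :
    (1 - q ^ (2 * (m + 1))) * coeff (m + 1) (eulerSeries q a * evenSeries b) =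
      (1 + q ^ (2 * m + 1)) * coeff m (eulerSeries q a * evenSeries b) := by
  have h := congrArg (coeff (m + 1)) (one_sub_X_mul_eulerSeries_mul_evenSeries ha hb)
  rw [sub_mul, one_mul, add_mul, one_mul, mul_assoc, map_sub, map_add, coeff_succ_X_mul,
    coeff_C_mul, coeff_succ_X_mul, coeff_rescale, coeff_rescale] at h
  linear_combination h

theorem coeff_eulerSeries_mul_evenSeries_zero {q : R} {a b : ℕ → R}
    (ha : ∀ n, qPoch q q n * a n = 1) (hb : ∀ n, qPoch (q ^ 4) (q ^ 4) n * b n = 1) :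
    coeff 0 (eulerSeries q a * evenSeries b) = 1 := by
  simp [coeff_mul, eulerSeries, evenSeries, apply_zero_of_qPoch_mul_eq_one ha,
    apply_zero_of_qPoch_mul_eq_one hb]

/-- The slack `m ≤ N` lets two consecutive coefficients be summed over the same square. -/
theorem coeff_eulerSeries_mul_evenSeries (q : R) (a b : ℕ → R) {m N : ℕ} (h : m ≤ N) :
    coeff m (eulerSeries q a * evenSeries b) =
      ∑ p ∈ Finset.range (N + 1) ×ˢ Finset.range (N + 1),
        if 2 * p.2 + p.1 = m then q ^ p.1.choose 2 * (a p.1 * b p.2) else 0 := by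
  rw [coeff_mul, ← Finset.sum_filter]
  simp only [eulerSeries, evenSeries, coeff_mk, mul_ite, mul_zero]
  rw [← Finset.sum_filter]
  refine Finset.sum_nbij' (fun p => (p.1, p.2 / 2)) (fun p => (p.1, 2 * p.2)) ?_ ?_ ?_ ?_ ?_
  · rintro ⟨i, j⟩ hp
    simp only [Finset.mem_filter, Finset.HasAntidiagonal.mem_antidiagonal, Finset.mem_product,
      Finset.mem_range,
      Nat.even_iff] at hp ⊢
    omega
  · rintro ⟨i, j⟩ hp
    simp only [Finset.mem_filter, Finset.HasAntidiagonal.mem_antidiagonal, Finset.mem_product,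
      Finset.mem_range,
      Nat.even_iff] at hp ⊢
    omega
  · rintro ⟨i, j⟩ hp
    simp only [Finset.mem_filter, Finset.HasAntidiagonal.mem_antidiagonal, Nat.even_iff] at hp
    simp only [Prod.mk.injEq, true_and]
    omega
  · rintro ⟨i, j⟩ -
    simp
  · rintro ⟨i, j⟩ -
    exact mul_assoc _ _ _

end PochhammerInverse

open PowerSeries in
theorem ggRow_one_eq {a b : ℕ → ℤ⟦X⟧} (ha : ∀ n, qPoch X X n * a n = 1)
    (hb : ∀ n, qPoch (X ^ 4) (X ^ 4) n * b n = 1) (m : ℕ) :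
    ggRow 1 m = X ^ m ^ 2 * coeff m (eulerSeries X a * evenSeries b) := by
  induction m with
  | zero => rw [ggRow_zero one_pos, coeff_eulerSeries_mul_evenSeries_zero ha hb]; simp
  | succ m ih =>
    have hu : IsUnit (1 - X ^ (2 * (m + 1)) : ℤ⟦X⟧) := by
      rw [PowerSeries.isUnit_iff_constantCoeff]
      simp
    apply hu.mul_left_cancel
    rw [ggRow_one_succ, ih]
    linear_combination (-X ^ (m + 1) ^ 2) * coeff_eulerSeries_mul_evenSeries_succ ha hb m

/-! ### Extracting the coefficient of a power of `x` -/

open PowerSeries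

/-- The coefficient of `x ^ M`, as a power series in `q`. -/
noncomputable def rowX (M : ℕ) : SeriesQX →+ ℤ⟦X⟧ where
  toFun f := PowerSeries.mk fun n =>
    MvPowerSeries.coeff (Finsupp.single 0 n + Finsupp.single 1 M) f
  map_zero' := by ext; simp
  map_add' f g := by ext; simp

theorem coeff_rowX (M n : ℕ) (f : SeriesQX) :
    coeff n (rowX M f) = MvPowerSeries.coeff (Finsupp.single 0 n + Finsupp.single 1 M) f :=
  coeff_mk n fun n => MvPowerSeries.coeff (Finsupp.single 0 n + Finsupp.single 1 M) f

theorem coeff_eq_coeff_rowX (d : Fin 2 →₀ ℕ) (f : SeriesQX) :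
    MvPowerSeries.coeff d f = coeff (d 0) (rowX (d 1) f) := by
  rw [coeff_rowX]
  refine congrArg (fun e => MvPowerSeries.coeff e f) (Finsupp.ext fun i => ?_)
  fin_cases i <;> simp

theorem rowX_one (M : ℕ) : rowX M 1 = if M = 0 then 1 else 0 := by
  ext n
  rw [coeff_rowX, MvPowerSeries.coeff_one]
  by_cases hM : M = 0 <;> simp [hM, coeff_one]

theorem rowX_varQ_pow_mul (M k : ℕ) (f : SeriesQX) :
    rowX M (varQ ^ k * f) = X ^ k * rowX M f := by
  ext n
  have h : (Finsupp.single 0 k ≤ Finsupp.single 0 n + Finsupp.single (1 : Fin 2) M) ↔ k ≤ n := by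
    simp [Finsupp.le_def, Fin.forall_fin_two]
  rw [coeff_rowX, coeff_X_pow_mul', varQ, MvPowerSeries.X_pow_eq, MvPowerSeries.coeff_monomial_mul]
  simp only [h, one_mul]
  split_ifs
  · rw [coeff_rowX]
    refine congrArg (fun e => MvPowerSeries.coeff e f) (Finsupp.ext fun i => ?_)
    fin_cases i <;> simp
  · rfl

theorem rowX_varX_pow_mul (M k : ℕ) (f : SeriesQX) :
    rowX M (varX ^ k * f) = if k ≤ M then rowX (M - k) f else 0 := by
  ext n
  have h : (Finsupp.single 1 k ≤ Finsupp.single 0 n + Finsupp.single (1 : Fin 2) M) ↔ k ≤ M := by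
    simp [Finsupp.le_def, Fin.forall_fin_two]
  rw [coeff_rowX, varX, MvPowerSeries.X_pow_eq, MvPowerSeries.coeff_monomial_mul]
  simp only [h, one_mul]
  split_ifs
  · rw [coeff_rowX]
    refine congrArg (fun e => MvPowerSeries.coeff e f) (Finsupp.ext fun i => ?_)
    fin_cases i <;> simp
  · simp

theorem rowX_qPoch_mul (M i j n : ℕ) (f : SeriesQX) :
    rowX M (qPoch (varQ ^ i) (varQ ^ j) n * f) = qPoch (X ^ i) (X ^ j) n * rowX M f := by
  induction n generalizing f with
  | zero => simp [qPoch]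
  | succ n ih =>
    rw [qPoch_succ, qPoch_succ, mul_assoc, ih, sub_mul, one_mul, ← pow_mul, ← pow_add, map_sub,
      rowX_varQ_pow_mul]
    ring

theorem rowX_invDenomGG {a b : ℕ → ℤ⟦X⟧} (ha : ∀ n, qPoch X X n * a n = 1)
    (hb : ∀ n, qPoch (X ^ 4) (X ^ 4) n * b n = 1) (M n₁ n₂ : ℕ) :
    rowX M (invDenomGG n₁ n₂) = if M = 0 then a n₁ * b n₂ else 0 := by
  have h := congrArg (rowX M) (denomGG_mul_invDenomGG n₁ n₂)
  have h1 := rowX_qPoch_mul M 1 1 n₁ (qPoch (varQ ^ 4) (varQ ^ 4) n₂ * invDenomGG n₁ n₂)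
  rw [pow_one, pow_one, rowX_qPoch_mul] at h1
  rw [denomGG, mul_assoc, h1, rowX_one] at h
  have h2 : rowX M (invDenomGG n₁ n₂) = a n₁ * b n₂ * if M = 0 then 1 else 0 := by
    rw [← h]
    linear_combination (-rowX M (invDenomGG n₁ n₂)) * ha n₁ -
      rowX M (invDenomGG n₁ n₂) * qPoch X X n₁ * a n₁ * hb n₂
  rw [h2, mul_ite, mul_one, mul_zero]

theorem rowX_term {a b : ℕ → ℤ⟦X⟧} (ha : ∀ n, qPoch X X n * a n = 1)
    (hb : ∀ n, qPoch (X ^ 4) (X ^ 4) n * b n = 1) (M e f k n₁ n₂ : ℕ) :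
    rowX M (varQ ^ e * (1 + varX * varQ ^ f) * varX ^ k * invDenomGG n₁ n₂) =
      (if k = M then X ^ e * (a n₁ * b n₂) else 0) +
        if k + 1 = M then X ^ (e + f) * (a n₁ * b n₂) else 0 := by
  have h : varQ ^ e * (1 + varX * varQ ^ f) * varX ^ k * invDenomGG n₁ n₂ =
      varQ ^ e * (varX ^ k * invDenomGG n₁ n₂) +
        varQ ^ (e + f) * (varX ^ (k + 1) * invDenomGG n₁ n₂) := by
    ring
  have key : ∀ j, rowX M (varX ^ j * invDenomGG n₁ n₂) =
      if j = M then a n₁ * b n₂ else 0 := by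
    intro j
    rw [rowX_varX_pow_mul, rowX_invDenomGG ha hb, ← ite_and]
    congr 1
    exact propext (by omega)
  rw [h, map_add, rowX_varQ_pow_mul, rowX_varQ_pow_mul, key, key, mul_ite, mul_ite, mul_zero,
    mul_zero]

/-- Apart from `i.choose 2`, the exponent depends only on the degree `2 * j + i` in `x`, so a power
of `q` factors out of each row. -/
theorem exponent_eq (i j : ℕ) :
    4 * j ^ 2 + 4 * j + (3 * i ^ 2 + 3 * i) / 2 + 4 * j * i =
      (2 * j + i) ^ 2 + 2 * (2 * j + i) + i.choose 2 := by
  have h : (3 * i ^ 2 + 3 * i) / 2 = i ^ 2 + 2 * i + i.choose 2 := by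
    apply Nat.div_eq_of_eq_mul_right two_pos
    induction i with
    | zero => simp
    | succ i ih =>
      rw [Nat.choose_succ_succ' i 1, Nat.choose_one_right]
      linarith
  rw [h]
  ring

theorem sum_rowX_term {a b : ℕ → ℤ⟦X⟧} (ha : ∀ n, qPoch X X n * a n = 1)
    (hb : ∀ n, qPoch (X ^ 4) (X ^ 4) n * b n = 1) (M : ℕ) :
    ∑ p ∈ Finset.range (M + 1) ×ˢ Finset.range (M + 1),
      rowX M (varQ ^ (4 * p.2 ^ 2 + 4 * p.2 + (3 * p.1 ^ 2 + 3 * p.1) / 2 + 4 * p.2 * p.1)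
          * (1 + varX * varQ ^ (4 * p.2 + 2 * p.1 + 2))
          * varX ^ (2 * p.2 + p.1)
          * invDenomGG p.1 p.2) = ggRow 2 M := by
  simp only [rowX_term ha hb, exponent_eq]
  rw [Finset.sum_add_distrib]
  have h1 : ∀ p : ℕ × ℕ, (if 2 * p.2 + p.1 = M then
      (X : ℤ⟦X⟧) ^ ((2 * p.2 + p.1) ^ 2 + 2 * (2 * p.2 + p.1) + p.1.choose 2) *
        (a p.1 * b p.2) else 0) =
      X ^ (M ^ 2 + 2 * M) *
        if 2 * p.2 + p.1 = M then X ^ p.1.choose 2 * (a p.1 * b p.2) else 0 := by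
    intro p
    split_ifs with h
    · rw [h]; ring
    · simp
  simp only [h1]
  rw [← Finset.mul_sum, ← coeff_eulerSeries_mul_evenSeries X a b le_rfl]
  cases M with
  | zero =>
    rw [coeff_eulerSeries_mul_evenSeries_zero ha hb, ggRow_zero two_pos]
    simp
  | succ m =>
    have h2 : ∀ p : ℕ × ℕ, (if 2 * p.2 + p.1 + 1 = m + 1 then
        (X : ℤ⟦X⟧) ^ ((2 * p.2 + p.1) ^ 2 + 2 * (2 * p.2 + p.1) + p.1.choose 2 +
          (4 * p.2 + 2 * p.1 + 2)) * (a p.1 * b p.2) else 0) =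
        X ^ (m ^ 2 + 4 * m + 2) *
          if 2 * p.2 + p.1 = m then X ^ p.1.choose 2 * (a p.1 * b p.2) else 0 := by
      intro p
      simp only [add_left_inj]
      split_ifs with h
      · rw [← h]; ring
      · simp
    simp only [h2]
    rw [← Finset.mul_sum, ← coeff_eulerSeries_mul_evenSeries X a b (Nat.le_succ m),
      ggRow_two_succ, ggRow_one_eq ha hb, ggRow_one_eq ha hb]
    ring

theorem exists_qPoch_mul_eq_one {k : ℕ} (hk : k ≠ 0) :
    ∃ a : ℕ → ℤ⟦X⟧, ∀ n, qPoch (X ^ k) (X ^ k) n * a n = 1 := by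
  refine ⟨fun n => invOfUnit (qPoch (X ^ k) (X ^ k) n) 1, fun n => mul_invOfUnit _ _ ?_⟩
  simp [qPoch, map_prod, hk]

theorem mainTheorem8 :
    HasSum
      (fun p : ℕ × ℕ =>
        varQ ^ (4 * p.2 ^ 2 + 4 * p.2 + (3 * p.1 ^ 2 + 3 * p.1) / 2 + 4 * p.2 * p.1)
          * (1 + varX * varQ ^ (4 * p.2 + 2 * p.1 + 2))
          * varX ^ (2 * p.2 + p.1)
          * invDenomGG p.1 p.2)
      (genFunQX partitionCountDo21) := by
  obtain ⟨a, ha⟩ := exists_qPoch_mul_eq_one one_ne_zero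
  obtain ⟨b, hb⟩ := exists_qPoch_mul_eq_one (k := 4) (by norm_num)
  simp only [pow_one] at ha
  rw [MvPowerSeries.WithPiTopology.hasSum_iff_hasSum_coeff]
  intro d
  have hd : MvPowerSeries.coeff d (genFunQX partitionCountDo21) =
      coeff (d 0) (ggRow 2 (d 1)) := by
    rw [ggRow, coeff_mk, card_ggLists_two]
    rfl
  rw [hd, ← sum_rowX_term ha hb, map_sum]
  simp only [coeff_eq_coeff_rowX d]
  refine hasSum_sum_of_ne_finset_zero fun p hp => ?_
  -- Outside the square both powers of `x` in the term exceed `d 1`, so each coefficient is a finite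
  -- sum.
  have hp' : d 1 < 2 * p.2 + p.1 := by
    simp only [Finset.mem_product, Finset.mem_range] at hp
    omega
  rw [rowX_term ha hb, if_neg (by omega), if_neg (by omega), add_zero, map_zero]
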